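/- Let $p$ be a prime and let $G$ be a finite group with a split $BN$-pair of characteristic $p$ (for instance, a finite group of Lie type defined in characteristic $p$). That is, $G=\langle B,N\rangle$ has a $BN$-pair $(B,N)$ with torus $T=B\cap N$ and Weyl group $W=N/T$, generated by a set $S$ of involutions, such that $B=UT$, where $U=O_p(B)$ is the largest normal $p$-subgroup of $B$ and $T$ is abelian of order prime to $p$, and $\bigcap_{n\in N}nBn^{-1}=T$. Let $k$ be an algebraically closed field of characteristic $r>0$ with $r\neq p$. For $J\subseteq S$ let $P_J$ be the standard parabolic subgroup, $L_J\supseteq T$ its standard Levi subgroup, and let $\mathscr{L}_G=\{nL_Jn^{-1} : J\subseteq S,\ n\in N\}$. For $L=nL_Jn^{-1}\in\mathscr{L}_G$, $P=nP_Jn^{-1}$ and a $kG$-module $Y$, let ${}^*R^G_L(Y)=Y^{O_p(P)}$, regarded as a $kL$-module (Harish-Chandra restriction). For an irreducible $kT$-module $X$, the principal series ${\rm Irr}_k(G|(T,X))$ is the set of (isomorphism classes of) irreducible $kG$-modules $Y$ such that $T$ is minimal among the $L\in\mathscr{L}_G$ with ${}^*R^G_L(Y)\neq 0$, and $X$ is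 a composition factor of ${}^*R^G_T(Y)=Y^U$. Let $X$ and $X'$ be irreducible $kT$-modules with ${\rm Irr}_k(G|(T,X))\neq{\rm Irr}_k(G|(T,X'))$. If $Y\in{\rm Irr}_k(G|(T,X))$ and $V\in{\rm Irr}_k(G|(T,X'))$, then ${\rm Ext}^1_{kG}(Y,V)=0$. -/

import Mathlib

open CategoryTheory
open scoped Pointwise MonoidAlgebra

universe u v w

/-- A BN-pair (Tits system) in a group `G`: subgroups `B` and `N` generating `G`, with `B ∩ N`
normal in `N`, and a set `S` of involutions generating `W = N / (B ∩ N)`, subject to the usual two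
axioms, which are stated for all representatives in `N` of the elements of `S` and of `W`. -/
structure BNPair (G : Type v) [Group G] where
  B : Subgroup G
  N : Subgroup G
  sup_eq_top : B ⊔ N = ⊤
  [normal : ((B ⊓ N).subgroupOf N).Normal]
  S : Set (N ⧸ (B ⊓ N).subgroupOf N)
  orderOf_eq_two : ∀ s ∈ S, orderOf s = 2
  closure_eq_top : Subgroup.closure S = ⊤
  mul_mem : ∀ s n : N, (s : N ⧸ (B ⊓ N).subgroupOf N) ∈ S → ∀ b ∈ B,
    (s : G) * b * n ∈ DoubleCoset.doubleCoset ((s : G) * n) (B : Set G) B ∪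
      DoubleCoset.doubleCoset (n : G) (B : Set G) B
  conj_ne : ∀ s : N, (s : N ⧸ (B ⊓ N).subgroupOf N) ∈ S → MulAut.conj (s : G) • B ≠ B

attribute [instance] BNPair.normal

/-- The largest normal `p`-subgroup `O_p(H)` of a (finite) group `H`: the subgroup generated by all
normal `p`-subgroups. -/
def pCore (p : ℕ) (H : Type v) [Group H] : Subgroup H :=
  ⨆ K : {K : Subgroup H // K.Normal ∧ IsPGroup p K}, K.1

instance pCore_normal (p : ℕ) (H : Type v) [Group H] : (pCore p H).Normal := by
  refine ⟨fun x hx g => ?_⟩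
  have key : pCore p H ≤ (pCore p H).comap (MulAut.conj g).toMonoidHom := by
    refine iSup_le fun K y hy => ?_
    exact (le_iSup (fun K : {K : Subgroup H // K.Normal ∧ IsPGroup p K} => K.1) K)
      (K.2.1.conj_mem y hy g)
  exact key hx

namespace BNPair

variable {G : Type v} [Group G] (D : BNPair G)

/-- The maximal torus `T = B ∩ N`. -/
def T : Subgroup G := D.B ⊓ D.N

theorem T_le_B : D.T ≤ D.B := inf_le_left

/-- The Weyl group `W = N / T`. -/
abbrev W : Type v := D.N ⧸ (D.B ⊓ D.N).subgroupOf D.N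

/-- The unipotent radical `U = O_p(B)` of the Borel subgroup, as a subgroup of `G`. -/
def U (p : ℕ) : Subgroup G := (pCore p D.B).map D.B.subtype

/-- The BN-pair is split, of characteristic `p`: `B = UT` where `U` is the largest normal
`p`-subgroup of `B` and `T = B ∩ N` is an abelian `p'`-group, and the intersection of the
`N`-conjugates of `B` is `T`. -/
structure IsSplit (p : ℕ) : Prop where
  mul_eq : (D.U p : Set G) * (D.T : Set G) = D.B
  comm : ∀ a ∈ D.T, ∀ b ∈ D.T, a * b = b * a
  not_dvd : ¬ p ∣ Nat.card D.T
  iInf_conj : ⨅ n : D.N, MulAut.conj (n : G) • D.B = D.T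

/-- The preimage `N_J` in `N` of the subgroup `W_J = ⟨J⟩` of `W`. -/
def NJ (J : Set D.W) : Subgroup G :=
  ((Subgroup.closure J).comap (QuotientGroup.mk' ((D.B ⊓ D.N).subgroupOf D.N))).map D.N.subtype

/-- The pairs `(P, L)` where `P = ⁿP_J` with `P_J = ⟨B, N_J⟩ = B W_J B` a standard parabolic
subgroup, `n ∈ N`, and `L = ⁿL_J`, where the standard Levi subgroup `L_J` is the intersection of
`P_J` with the opposite parabolic subgroup `⟨B⁻, N_J⟩`. Here `B⁻ = ^{m}B` is the opposite Borel
subgroup, i.e. `m ∈ N` and `B ∩ B⁻ = T` (so `m` represents the longest element of `W`). -/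
def IsParabolicLevi (P L : Subgroup G) : Prop :=
  ∃ J ⊆ D.S, ∃ m ∈ D.N, D.B ⊓ MulAut.conj m • D.B = D.T ∧ ∃ n ∈ D.N,
    P = MulAut.conj n • (D.B ⊔ D.NJ J) ∧
    L = MulAut.conj n • ((D.B ⊔ D.NJ J) ⊓ ((MulAut.conj m • D.B) ⊔ D.NJ J))

variable {D} in
theorem IsParabolicLevi.le {P L : Subgroup G} (h : D.IsParabolicLevi P L) : L ≤ P := by
  obtain ⟨J, -, m, -, -, n, -, rfl, rfl⟩ := h
  exact Subgroup.pointwise_smul_le_pointwise_smul_iff.2 inf_le_left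

end BNPair

section HarishChandra

variable {k : Type u} [Field k] {G : Type v} [Group G]

/-- Harish-Chandra restriction `*R^G_{L ⊆ P}(Y) = Y^{U_P}`, with `U_P = O_p(P)`, as a
representation of `L`. -/
noncomputable def hcRestriction (p : ℕ) {P L : Subgroup G} (h : L ≤ P) (Y : Rep.{w} k G) :
    Rep.{w} k L :=
  Rep.res (Subgroup.inclusion h) ((Rep.res P.subtype Y).toInvariants (pCore p P))

/-- The irreducible representation `X` is a composition factor of `M`, i.e. a quotient of a
subrepresentation of `M`. -/
def IsCompositionFactor {H : Type v} [Group H] (X M : Rep.{w} k H) : Prop :=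
  X.ρ.IsIrreducible ∧ ∃ (A : Subrepresentation M.ρ)
    (f : A.toRepresentation.IntertwiningMap X.ρ), Function.Surjective f

/-- The Harish-Chandra series `Irr_k(G | (L, X))`, where `*R^G_L` is computed through the parabolic
subgroup `P` with Levi complement `L`: the irreducible `Y` such that `X` is a composition factor of
`*R^G_L(Y)` and `L` is minimal with `*R^G_L(Y) ≠ 0`. It is given as an isomorphism-closed class of
representations, so that equality of series is equality of the sets of isomorphism classes. -/
def hcSeries (p : ℕ) (D : BNPair G) {P L : Subgroup G} (h : L ≤ P) (X : Rep.{w} k L) :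
    Set (Rep.{w} k G) :=
  {Y | Y.ρ.IsIrreducible ∧
    (Nontrivial (hcRestriction p h Y) ∧
      ∀ (P' L' : Subgroup G) (h' : D.IsParabolicLevi P' L'), L' < L →
        Subsingleton (hcRestriction p h'.le Y)) ∧
    IsCompositionFactor X (hcRestriction p h Y)}

/-- The principal series `Irr_k(G | (T, X))`; here `T` is a Levi complement of `B = P_∅`. -/
def principalSeries (p : ℕ) (D : BNPair G) (X : Rep.{w} k D.T) : Set (Rep.{w} k G) :=
  hcSeries p D D.T_le_B X

end HarishChandra

/-!
Let `T'` be the subgroup of the elements of `T` whose order is invertible in `k`. For a linear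
character `χ` of `T'` let `f_χ` be the idempotent of `kG` which projects onto the `χ`-isotypic part
of the `U`-invariants. A linear character of `T` is determined by its restriction to `T'`, so a
simple module with `T`-character `χ` occurs in `Y^U` if and only if `f_χ` does not kill `Y`, even
when `kT` is not semisimple.

If `ψ` is not an `N`-conjugate of `χ`, then `f_ψ kG f_χ = 0` by the Bruhat decomposition, and so
`f_ψ` kills the kernel of a projection `kG f_χ → Y` onto a simple module `Y` not killed by
`f_χ`. A simple module `V` not killed by `f_ψ` therefore receives no nonzero map from this kernel,
and `Ext¹(Y, V) = 0` because `kG f_χ` is projective.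

If `ψ` is conjugate to `χ`, then `f_ψ` and `f_χ` generate the same two-sided ideal, so the two
principal series agree. It suffices to see this for a simple reflection `s` with `ˢχ ≠ χ`, where
`f_χ s e_U s f_χ` is a nonzero multiple of `s² f_χ` and the left-hand side lies in the ideal
generated by the idempotent of `ˢχ`; here `e_U` is the projection onto the `U`-invariants.
-/

section Ext

theorem subsingleton_ext_one_of_forall_eq_zero {C : Type u} [Category.{v} C] [Abelian C]
    [HasExt.{w} C] {S : ShortComplex C} (hS : S.ShortExact) [Projective S.X₂] {V : C}
    (h : ∀ φ : S.X₁ ⟶ V, φ = 0) : Subsingleton (Abelian.Ext.{w} S.X₃ V 1) := by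
  refine subsingleton_of_forall_eq 0 fun x => ?_
  obtain ⟨z, rfl⟩ := Abelian.Ext.contravariant_sequence_exact₃ hS V x
    (Abelian.Ext.eq_zero_of_projective _) (add_zero 1)
  rw [← Abelian.Ext.mk₀_addEquiv₀_apply z, h (Abelian.Ext.addEquiv₀ z), Abelian.Ext.mk₀_zero,
    Abelian.Ext.comp_zero]

variable {R : Type u} [Ring R]

theorem mul_eq_self_of_mem_span_singleton {f x : R} (hf : IsIdempotentElem f) (hx : x ∈ R ∙ f) :
    x * f = x := by
  obtain ⟨c, rfl⟩ := Submodule.mem_span_singleton.1 hx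
  rw [smul_eq_mul, mul_assoc, hf]

theorem projective_span_singleton {f : R} (hf : IsIdempotentElem f) :
    Module.Projective R (R ∙ f) :=
  .of_split (R ∙ f).subtype
    ((LinearMap.toSpanSingleton R R f).codRestrict _ fun c =>
      Submodule.mem_span_singleton.2 ⟨c, rfl⟩)
    (LinearMap.ext fun x => Subtype.ext (mul_eq_self_of_mem_span_singleton hf x.2))

theorem subsingleton_ext_one_of_mul_mul_eq_zero {f f' : R} (hf : IsIdempotentElem f)
    (h : ∀ c, f' * c * f = 0) {Y V : ModuleCat.{u} R} [IsSimpleModule R Y] [IsSimpleModule R V]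
    (hY : f ∉ Module.annihilator R Y) (hV : f' ∉ Module.annihilator R V) :
    Subsingleton (Abelian.Ext.{u} Y V 1) := by
  simp only [Module.mem_annihilator, not_forall] at hY hV
  obtain ⟨y, hy⟩ := hY
  obtain ⟨v, hv⟩ := hV
  have : Projective (ModuleCat.of R (R ∙ f)) :=
    have := projective_span_singleton hf
    ModuleCat.projective_of_categoryTheory_projective _
  let π : (R ∙ f) →ₗ[R] Y := LinearMap.toSpanSingleton R Y y ∘ₗ (R ∙ f).subtype
  have hπ : Function.Surjective π := LinearMap.surjective_of_ne_zero fun h0 =>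
    hy (LinearMap.congr_fun h0 ⟨f, Submodule.mem_span_singleton_self f⟩)
  let S : ShortComplex (ModuleCat.{u} R) :=
    .mk (ModuleCat.ofHom (LinearMap.ker π).subtype) (ModuleCat.ofHom π) (by ext x; exact x.2)
  have hS : S.ShortExact :=
    { exact := by
        rw [ShortComplex.ShortExact.moduleCat_exact_iff_function_exact]
        exact LinearMap.exact_subtype_ker_map π
      mono_f := (ModuleCat.mono_iff_injective _).2 Subtype.val_injective
      epi_g := (ModuleCat.epi_iff_surjective _).2 hπ }
  have h_smul (x : LinearMap.ker π) : f' • x = 0 := by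
    ext
    change f' * (x : R) = 0
    rw [← mul_eq_self_of_mem_span_singleton hf x.1.2, ← mul_assoc, h]
  refine subsingleton_ext_one_of_forall_eq_zero hS fun φ => ?_
  by_contra hφ
  obtain ⟨x, rfl⟩ := LinearMap.surjective_of_ne_zero (fun h0 => hφ (ModuleCat.hom_ext h0)) v
  exact hv (by rw [← map_smul, h_smul x, map_zero])

end Ext

open MonoidAlgebra (of)

section Weights

variable {k : Type u} [Field k] {H A : Type*} [Group H] [Group A]

/-- The vectors of the `kH`-module `V` on which a group `A`, acting through `φ : A →* H`, acts by
the linear character `χ`. -/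
def weightSpace (V : Type*) [AddCommGroup V] [Module k V] [Module k[H] V] [IsScalarTower k k[H] V]
    (φ : A →* H) (χ : A →* k) : Submodule k V where
  carrier := {v | ∀ a, of k H (φ a) • v = χ a • v}
  add_mem' hv hw a := by rw [smul_add, hv a, hw a, smul_add]
  zero_mem' a := by rw [smul_zero, smul_zero]
  smul_mem' c v hv a := by rw [smul_comm, hv a, smul_comm]

/-- The element `|A|⁻¹ ∑ₐ χ(a⁻¹) φ(a)` of `kH`; if `|A|` is invertible in `k`, it is the idempotent
which projects every `kH`-module onto its weight space for `χ`. -/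
noncomputable def charIdem [Finite A] (φ : A →* H) (χ : A →* k) : k[H] :=
  letI := Fintype.ofFinite A
  (Nat.card A : k)⁻¹ • ∑ a, χ a⁻¹ • of k H (φ a)

variable {V : Type*} [AddCommGroup V] [Module k V] [Module k[H] V] [IsScalarTower k k[H] V]
  {φ : A →* H} {χ ψ : A →* k}

theorem smul_mem_weightSpace {c : k[H]} (hc : ∀ a, Commute (of k H (φ a)) c) {v : V}
    (hv : v ∈ weightSpace V φ χ) : c • v ∈ weightSpace V φ χ := fun a => by
  rw [smul_smul, hc a, mul_smul, hv a, smul_comm]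

theorem exists_mem_weightSpace_of_smul_mem_span {v : V} (hv : v ≠ 0)
    (h : ∀ a, of k H (φ a) • v ∈ k ∙ v) : ∃ χ : A →* k, v ∈ weightSpace V φ χ := by
  choose χ hχ using fun a => Submodule.mem_span_singleton.1 (h a)
  refine ⟨⟨⟨χ, ?_⟩, fun a b => smul_left_injective k hv ?_⟩, fun a => (hχ a).symm⟩
  · exact smul_left_injective k hv (by simp only [hχ, map_one, one_smul])
  · change χ (a * b) • v = (χ a * χ b) • v
    rw [mul_comm, mul_smul, hχ, hχ, smul_comm, hχ, map_mul, map_mul, mul_smul]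

section Finite

variable [Finite A]

theorem of_mul_charIdem (φ : A →* H) (χ : A →* k) (a : A) :
    of k H (φ a) * charIdem φ χ = χ a • charIdem φ χ := by
  let := Fintype.ofFinite A
  rw [charIdem, mul_smul_comm, smul_comm (χ a), Finset.mul_sum, Finset.smul_sum (r := χ a)]
  refine congrArg _ (Fintype.sum_equiv (Equiv.mulLeft a) _ _ fun b => ?_)
  rw [mul_smul_comm, ← map_mul, ← map_mul, Equiv.coe_mulLeft, smul_smul, mul_comm (χ a), ← map_mul,
    mul_inv_rev, inv_mul_cancel_right]

theorem charIdem_mul_of (φ : A →* H) (χ : A →* k) (a : A) :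
    charIdem φ χ * of k H (φ a) = χ a • charIdem φ χ := by
  let := Fintype.ofFinite A
  rw [charIdem, smul_mul_assoc, smul_comm (χ a), Finset.sum_mul, Finset.smul_sum (r := χ a)]
  refine congrArg _ (Fintype.sum_equiv (Equiv.mulRight a) _ _ fun b => ?_)
  rw [smul_mul_assoc, ← map_mul, ← map_mul, Equiv.coe_mulRight, smul_smul, ← map_mul, mul_inv_rev,
    mul_inv_cancel_left]

theorem charIdem_smul_mem_weightSpace (φ : A →* H) (χ : A →* k) (v : V) :
    charIdem φ χ • v ∈ weightSpace V φ χ := fun a => by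
  rw [smul_smul, of_mul_charIdem, smul_assoc]

theorem charIdem_smul_eq_self (hA : (Nat.card A : k) ≠ 0) {v : V} (hv : v ∈ weightSpace V φ χ) :
    charIdem φ χ • v = v := by
  have h_term (a : A) : χ a⁻¹ • of k H (φ a) • v = v := by
    rw [hv a, smul_smul, ← map_mul, inv_mul_cancel, map_one, one_smul]
  simp only [charIdem, smul_assoc, Finset.sum_smul, h_term, Finset.sum_const, Finset.card_univ,
    ← Nat.card_eq_fintype_card]
  rw [← Nat.cast_smul_eq_nsmul k, smul_smul, inv_mul_cancel₀ hA, one_smul]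

theorem charIdem_smul_eq_zero (h : ψ ≠ χ) {v : V} (hv : v ∈ weightSpace V φ χ) :
    charIdem φ ψ • v = 0 := by
  obtain ⟨a, ha⟩ := DFunLike.ne_iff.1 h
  have h_eq : ψ a • charIdem φ ψ • v = χ a • charIdem φ ψ • v := by
    rw [← smul_assoc, ← charIdem_mul_of, mul_smul, hv a, smul_comm]
  rwa [← sub_eq_zero, ← sub_smul, smul_eq_zero_iff_right (sub_ne_zero.2 ha)] at h_eq

theorem charIdem_mem_weightSpace (φ : A →* H) (χ : A →* k) :
    charIdem φ χ ∈ weightSpace k[H] φ χ := of_mul_charIdem φ χ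

theorem isIdempotentElem_charIdem (φ : A →* H) (χ : A →* k) (hA : (Nat.card A : k) ≠ 0) :
    IsIdempotentElem (charIdem φ χ) :=
  charIdem_smul_eq_self hA (charIdem_mem_weightSpace φ χ)

theorem charIdem_mul_charIdem_of_ne (φ : A →* H) (h : ψ ≠ χ) :
    charIdem φ ψ * charIdem φ χ = 0 :=
  charIdem_smul_eq_zero h (charIdem_mem_weightSpace φ χ)

theorem commute_charIdem {c : k[H]} (hc : ∀ a, Commute (of k H (φ a)) c) :
    Commute (charIdem φ χ) c :=
  .smul_left (.sum_left _ _ _ fun a _ => (hc a).smul_left _) _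

end Finite

end Weights

section Conjugation

variable {k : Type u} [Field k] {G : Type v} [Group G] {H : Subgroup G}

/-- The conjugate `h ↦ χ (g⁻¹ * h * g)` of a linear character `χ` of `H` by an element `g`
normalizing `H`. -/
def conjChar (g : Subgroup.normalizer (H : Set G)) (χ : H →* k) : H →* k :=
  χ.comp (H.normalizerMonoidHom g⁻¹ : H ≃* H).toMonoidHom

theorem conjChar_mul (g g' : Subgroup.normalizer (H : Set G)) (χ : H →* k) :
    conjChar (g * g') χ = conjChar g (conjChar g' χ) := by
  ext h
  simp [conjChar]

theorem conjChar_inv_conjChar (g : Subgroup.normalizer (H : Set G)) (χ : H →* k) :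
    conjChar g⁻¹ (conjChar g χ) = χ := by
  rw [← conjChar_mul, inv_mul_cancel]
  ext h
  simp [conjChar]

theorem conjChar_eq_self {g : Subgroup.normalizer (H : Set G)}
    (hg : ∀ h ∈ H, Commute (g : G) h) (χ : H →* k) : conjChar g χ = χ := by
  have hg' : g⁻¹ ∈ H.normalizerMonoidHom.ker := by
    rw [Subgroup.normalizerMonoidHom_ker]
    exact inv_mem (Subgroup.mem_subgroupOf.2 (Subgroup.mem_centralizer_iff.2
      fun h hh => (hg h hh).eq.symm))
  ext h
  simp [conjChar, MonoidHom.mem_ker.1 hg']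

theorem of_mul_charIdem_subtype [Finite H] (g : Subgroup.normalizer (H : Set G)) (χ : H →* k) :
    of k G g * charIdem H.subtype χ = charIdem H.subtype (conjChar g χ) * of k G g := by
  let := Fintype.ofFinite H
  simp only [charIdem, mul_smul_comm, smul_mul_assoc, Finset.mul_sum, Finset.sum_mul]
  refine congrArg _ (Fintype.sum_equiv (H.normalizerMonoidHom g).toEquiv _ _ fun h => ?_)
  have h_char : conjChar g χ (H.normalizerMonoidHom g h)⁻¹ = χ h⁻¹ := by
    simp [conjChar]
  have h_mul : (g : G) * h = (H.normalizerMonoidHom g h : G) * g :=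
    (inv_mul_cancel_right ((g : G) * h) g).symm
  rw [MulEquiv.toEquiv_eq_coe, MulEquiv.coe_toEquiv, h_char, H.subtype_apply, H.subtype_apply,
    ← map_mul, ← map_mul, h_mul]

end Conjugation

section CompositionFactors

variable {k : Type u} [Field k] {H : Type v} [Group H]

section Modules

variable {V : Type*} [AddCommGroup V] [Module k V] [Module k[H] V] [IsScalarTower k k[H] V]

theorem smul_eq_lift_smul {χ : H →* k} {v : V} (hv : v ∈ weightSpace V (.id H) χ) (c : k[H]) :
    c • v = MonoidAlgebra.lift k k H χ c • v := by
  induction c using MonoidAlgebra.induction_on with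
  | of g => rw [MonoidAlgebra.lift_of]; exact hv g
  | add a b ha hb => rw [add_smul, ha, hb, map_add, add_smul]
  | smul r a ha => rw [smul_assoc, ha, map_smul, smul_assoc]

theorem weightSpace_eq_top [IsSimpleModule k[H] V] {χ : H →* k}
    (h : weightSpace V (.id H) χ ≠ ⊥) : weightSpace V (.id H) χ = ⊤ := by
  obtain ⟨v, hv, hv0⟩ := Submodule.exists_mem_ne_zero_of_ne_bot h
  refine Submodule.eq_top_iff'.2 fun w => ?_
  obtain ⟨c, rfl⟩ := IsSimpleModule.toSpanSingleton_surjective k[H] hv0 w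
  rw [LinearMap.toSpanSingleton_apply, smul_eq_lift_smul hv]
  exact Submodule.smul_mem _ _ hv

theorem exists_isSimpleModule_of_isArtinianRing (R : Type*) [Ring R] [IsArtinianRing R]
    (M : Type*) [AddCommGroup M] [Module R M] [Nontrivial M] :
    ∃ S : Submodule R M, IsSimpleModule R S := by
  obtain ⟨v, hv⟩ := exists_ne (0 : M)
  have : Nontrivial (R ∙ v) := Submodule.nontrivial_span_singleton hv
  obtain ⟨S, hS⟩ := IsAtomic.exists_atom (Submodule R (R ∙ v))
  have := isSimpleModule_iff_isAtom.2 hS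
  exact ⟨S.map (R ∙ v).subtype,
    .congr (S.equivMapOfInjective _ (R ∙ v).subtype_injective).symm⟩

open scoped IsMulCommutative in
theorem exists_weightSpace_ne_bot [IsAlgClosed k] [Finite H] [IsMulCommutative H] [Nontrivial V] :
    ∃ χ : H →* k, weightSpace V (.id H) χ ≠ ⊥ := by
  have : IsArtinianRing k[H] := .of_finite k _
  obtain ⟨S, hS⟩ := exists_isSimpleModule_of_isArtinianRing k[H] V
  have : Module.Finite k S := .trans k[H] S
  have h_rank : Module.finrank k S = 1 := IsSimpleModule.finrank_eq_one_of_isMulCommutative k[H] S k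
  obtain ⟨v, hv, hspan⟩ := finrank_eq_one_iff'.1 h_rank
  obtain ⟨χ, hχ⟩ := exists_mem_weightSpace_of_smul_mem_span (φ := .id H) hv
    fun a => Submodule.mem_span_singleton.2 (hspan _)
  refine ⟨χ, Submodule.ne_bot_iff _ |>.2 ⟨v, fun a => ?_, Subtype.coe_ne_coe.2 hv⟩⟩
  exact congrArg Subtype.val (hχ a)

theorem exists_weightSpace_eq_top [IsAlgClosed k] [Finite H] [IsMulCommutative H]
    [IsSimpleModule k[H] V] : ∃ χ : H →* k, weightSpace V (.id H) χ = ⊤ :=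
  have := IsSimpleModule.nontrivial k[H] V
  exists_weightSpace_ne_bot.imp fun _ => weightSpace_eq_top

open scoped IsMulCommutative in
theorem weightSpace_id_ne_bot_of_comp [IsAlgClosed k] [Finite H] [IsMulCommutative H]
    {A : Type*} [Group A] {φ : A →* H} (hφ : Function.Injective fun χ : H →* k => χ.comp φ)
    {χ : H →* k} (h : weightSpace V φ (χ.comp φ) ≠ ⊥) : weightSpace V (.id H) χ ≠ ⊥ := by
  let W : Submodule k[H] V :=
    { weightSpace V φ (χ.comp φ) with
      smul_mem' := fun c _ hv => smul_mem_weightSpace (fun a => Commute.all (of k H (φ a)) c) hv }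
  obtain ⟨v, hv, hv0⟩ := Submodule.exists_mem_ne_zero_of_ne_bot h
  have : Nontrivial W := Submodule.nontrivial_iff_ne_bot.2 (W.ne_bot_iff.2 ⟨v, hv, hv0⟩)
  obtain ⟨ψ, hψ⟩ := exists_weightSpace_ne_bot (k := k) (H := H) (V := W)
  obtain ⟨w, hw, hw0⟩ := Submodule.exists_mem_ne_zero_of_ne_bot hψ
  have h_eq : ψ.comp φ = χ.comp φ := MonoidHom.ext fun a =>
    smul_left_injective k hw0 ((hw (φ a)).symm.trans (Subtype.ext (w.2 a)))
  rw [← hφ h_eq]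
  exact (Submodule.ne_bot_iff _).2
    ⟨w, fun a => congrArg Subtype.val (hw a), Subtype.coe_ne_coe.2 hw0⟩

end Modules

theorem mem_weightSpace_asModule {A W : Type*} [Group A] [AddCommGroup W] [Module k W]
    {ρ : Representation k H W} {φ : A →* H} {χ : A →* k} {v : ρ.asModule} :
    v ∈ weightSpace ρ.asModule φ χ ↔ ∀ a, ρ (φ a) v = χ a • ρ.asModuleEquiv v := by
  refine forall_congr' fun a => ?_
  rw [← ρ.asModuleEquiv.injective.eq_iff, Representation.asModuleEquiv_map_smul,
    Representation.asAlgebraHom_of, map_smul]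
  rfl

theorem isCompositionFactor_of_weightSpace_ne_bot {χ : H →* k} {X M : Rep.{w} k H}
    (hX : X.ρ.IsIrreducible) (hχ : weightSpace X.ρ.asModule (.id H) χ = ⊤)
    (hM : weightSpace M.ρ.asModule (.id H) χ ≠ ⊥) : IsCompositionFactor X M := by
  obtain ⟨v, hv, hv0⟩ := Submodule.exists_mem_ne_zero_of_ne_bot hM
  have : Nontrivial X := IsSimpleModule.nontrivial k[H] X.ρ.asModule
  obtain ⟨x, hx⟩ := exists_ne (0 : X)
  let E : Subrepresentation M.ρ :=
    { toSubmodule :=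
        { carrier := {z | ∀ g, M.ρ g z = χ g • z}
          add_mem' := fun hz hz' g => by rw [map_add, hz g, hz' g, smul_add]
          zero_mem' := fun g => by rw [map_zero, smul_zero]
          smul_mem' := fun c z hz g => by rw [map_smul, hz g, smul_comm] }
      apply_mem_toSubmodule := fun g z hz g' => by rw [hz g, map_smul, hz g', smul_comm] }
  let v' : E.toSubmodule := ⟨v, mem_weightSpace_asModule.1 hv⟩
  obtain ⟨l, hl⟩ := Module.Projective.exists_dual_eq_one k (x := v')
    fun h => hv0 (congrArg Subtype.val h)
  let f : E.toRepresentation.IntertwiningMap X.ρ :=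
    (l.smulRight x).intertwiningMap_of_isIntertwiningMap _ _ fun g z => by
      have h_left : E.toRepresentation g z = χ g • z := Subtype.ext (z.2 g)
      have h_right : X.ρ g (l.smulRight x z) = χ g • l.smulRight x z :=
        mem_weightSpace_asModule.1 (hχ ▸ Submodule.mem_top) g
      rw [h_left, map_smul, h_right]
  refine ⟨hX, E, f, (Representation.IsIrreducible.surjective_or_eq_zero f).resolve_right
    fun h0 => hx ?_⟩
  calc x = l v' • x := by rw [hl, one_smul]
    _ = f v' := rfl
    _ = 0 := by rw [h0]; rfl

theorem weightSpace_ne_bot_of_isCompositionFactor {A : Type*} [Group A] [Finite A]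
    (hA : (Nat.card A : k) ≠ 0) (φ : A →* H) {χ : H →* k} {X M : Rep.{w} k H}
    (hχ : weightSpace X.ρ.asModule (.id H) χ = ⊤) (hXM : IsCompositionFactor X M) :
    weightSpace M.ρ.asModule φ (χ.comp φ) ≠ ⊥ := by
  obtain ⟨hX, E, f, hf⟩ := hXM
  have : Nontrivial X := IsSimpleModule.nontrivial k[H] X.ρ.asModule
  obtain ⟨x, hx⟩ := exists_ne (0 : X)
  obtain ⟨z, rfl⟩ := hf x
  let f' := Representation.IntertwiningMap.equivLinearMapAsModule _ _ f
  let z' : E.toRepresentation.asModule := z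
  let e := charIdem φ (χ.comp φ)
  have h_mem : f' z' ∈ weightSpace X.ρ.asModule φ (χ.comp φ) := fun a =>
    (hχ ▸ Submodule.mem_top : f' z' ∈ weightSpace X.ρ.asModule (.id H) χ) (φ a)
  have h_image : f' (e • z') = f z := by
    rw [map_smul, charIdem_smul_eq_self hA h_mem]
    rfl
  have h_ne : e • z' ≠ 0 := fun h0 => hx (by rw [← h_image, h0]; exact map_zero f')
  have h_weight := mem_weightSpace_asModule.1 (charIdem_smul_mem_weightSpace φ (χ.comp φ) z')
  refine (Submodule.ne_bot_iff _).2 ⟨(e • z' : E.toSubmodule).1, ?_, fun h0 => h_ne ?_⟩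
  · exact mem_weightSpace_asModule.2 fun a => congrArg Subtype.val (h_weight a)
  · exact Subtype.ext h0

theorem isCompositionFactor_iff [IsAlgClosed k] [Finite H] [IsMulCommutative H]
    {A : Type*} [Group A] [Finite A] (hA : (Nat.card A : k) ≠ 0) {φ : A →* H}
    (hφ : Function.Injective fun χ : H →* k => χ.comp φ) {χ : H →* k} {X : Rep.{w} k H}
    (hX : X.ρ.IsIrreducible) (hχ : weightSpace X.ρ.asModule (.id H) χ = ⊤) (M : Rep.{w} k H) :
    IsCompositionFactor X M ↔ weightSpace M.ρ.asModule φ (χ.comp φ) ≠ ⊥ :=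
  ⟨weightSpace_ne_bot_of_isCompositionFactor hA φ hχ, fun h =>
    isCompositionFactor_of_weightSpace_ne_bot hX hχ (weightSpace_id_ne_bot_of_comp hφ h)⟩

end CompositionFactors

theorem isPGroup_pCore (p : ℕ) (H : Type v) [Group H] : IsPGroup p (pCore p H) :=
  have (K : {K : Subgroup H // K.Normal ∧ IsPGroup p K}) : K.1.Normal := K.2.1
  Sylow.iSup_of_normal _ fun K => K.2.2

namespace BNPair

variable {G : Type v} [Group G] {D : BNPair G}

section Bruhat

open DoubleCoset

theorem mk_eq_one_iff (n : D.N) : (n : D.W) = 1 ↔ (n : G) ∈ D.T := by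
  rw [QuotientGroup.eq_one_iff]
  exact Subgroup.mem_subgroupOf

theorem mul_self_mem_T {s : D.N} (hs : (s : D.W) ∈ D.S) : (s * s : G) ∈ D.T := by
  rw [← Subgroup.coe_mul, ← mk_eq_one_iff, QuotientGroup.mk_mul, ← pow_two,
    ← D.orderOf_eq_two _ hs, pow_orderOf_eq_one]

theorem N_induction {q : D.N → Prop} (torus : ∀ t : D.N, (t : G) ∈ D.T → q t)
    (mul : ∀ s n : D.N, (s : D.W) ∈ D.S → q n → q (s * n)) (n : D.N) : q n := by
  have h_mul (s) (hs : s ∈ D.S) (w : D.W) (ih : ∀ n : D.N, (n : D.W) = w → q n) (n : D.N)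
      (hn : (n : D.W) = s * w) : q n := by
    obtain ⟨s, rfl⟩ := QuotientGroup.mk_surjective s
    rw [← mul_inv_cancel_left s n]
    refine mul s _ hs (ih _ ?_)
    rw [QuotientGroup.mk_mul, hn, QuotientGroup.mk_inv, inv_mul_cancel_left]
  have h_inv (s) (hs : s ∈ D.S) : s⁻¹ = s := by
    rw [inv_eq_iff_mul_eq_one, ← pow_two, ← D.orderOf_eq_two s hs, pow_orderOf_eq_one]
  suffices h : ∀ w ∈ Subgroup.closure D.S, ∀ n : D.N, (n : D.W) = w → q n from
    h n (D.closure_eq_top ▸ Subgroup.mem_top _) n rfl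
  intro w hw
  induction hw using Subgroup.closure_induction_left with
  | one => exact fun n hn => torus n ((mk_eq_one_iff n).1 hn)
  | mul_left s hs w _ ih => exact h_mul s hs w ih
  | inv_mul_cancel s hs w _ ih => exact (h_inv s hs).symm ▸ h_mul s hs w ih

theorem mul_mul_mem_doubleCoset {a b c g : G} (hb : b ∈ D.B) (hc : c ∈ D.B)
    (hg : g ∈ doubleCoset a (D.B : Set G) D.B) : b * g * c ∈ doubleCoset a (D.B : Set G) D.B := by
  obtain ⟨x, hx, y, hy, rfl⟩ := mem_doubleCoset.1 hg
  exact mem_doubleCoset.2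
    ⟨b * x, D.B.mul_mem hb hx, y * c, D.B.mul_mem hy hc, by simp only [mul_assoc]⟩

theorem exists_mul_mul_mem_doubleCoset (n m : D.N) {b : G} (hb : b ∈ D.B) :
    ∃ l : D.N, (n * b * m : G) ∈ doubleCoset (l : G) (D.B : Set G) D.B := by
  induction n using N_induction with
  | torus t ht =>
    have h := mul_mul_mem_doubleCoset (D.B.mul_mem ht.1 hb) D.B.one_mem
      (mem_doubleCoset_self D.B D.B (m : G))
    exact ⟨m, by rwa [mul_one] at h⟩
  | mul s n hs ih =>
    obtain ⟨l, hl⟩ := ih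
    obtain ⟨c, hc, c', hc', h_eq⟩ := mem_doubleCoset.1 hl
    have h_mul : ((s * n : D.N) * b * m : G) = 1 * (s * c * l) * c' := by
      rw [Subgroup.coe_mul, mul_assoc, mul_assoc, ← mul_assoc (n : G), h_eq, one_mul]
      simp only [mul_assoc]
    rw [h_mul]
    rcases D.mul_mem s l hs c hc with h | h
    · exact ⟨s * l, mul_mul_mem_doubleCoset D.B.one_mem hc' h⟩
    · exact ⟨l, mul_mul_mem_doubleCoset D.B.one_mem hc' h⟩

theorem exists_mem_doubleCoset (D : BNPair G) (g : G) :
    ∃ n : D.N, g ∈ doubleCoset (n : G) (D.B : Set G) D.B := by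
  have hg : g ∈ Subgroup.closure (D.B ∪ D.N : Set G) := by
    rw [← Subgroup.sup_eq_closure, D.sup_eq_top]
    exact Subgroup.mem_top g
  induction hg using Subgroup.closure_induction with
  | mem g hg =>
    rcases hg with hg | hg
    · exact ⟨1, mem_doubleCoset.2 ⟨g, hg, 1, D.B.one_mem, by simp⟩⟩
    · exact ⟨⟨g, hg⟩, mem_doubleCoset_self _ _ _⟩
  | one => exact ⟨1, mem_doubleCoset_self _ _ _⟩
  | mul g g' _ _ ih ih' =>
    obtain ⟨n, hn⟩ := ih
    obtain ⟨m, hm⟩ := ih'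
    obtain ⟨b, hb, c, hc, rfl⟩ := mem_doubleCoset.1 hn
    obtain ⟨b', hb', c', hc', rfl⟩ := mem_doubleCoset.1 hm
    obtain ⟨l, hl⟩ := exists_mul_mul_mem_doubleCoset n m (D.B.mul_mem hc hb')
    have h := mul_mul_mem_doubleCoset hb hc' hl
    exact ⟨l, by simpa only [mul_assoc] using h⟩
  | inv g _ ih =>
    obtain ⟨n, hn⟩ := ih
    obtain ⟨b, hb, c, hc, rfl⟩ := mem_doubleCoset.1 hn
    exact ⟨n⁻¹, mem_doubleCoset.2 ⟨c⁻¹, inv_mem hc, b⁻¹, inv_mem hb, by simp [mul_assoc]⟩⟩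

end Bruhat

section Unipotent

variable {p : ℕ}

theorem U_le_B (D : BNPair G) : D.U p ≤ D.B := Subgroup.map_subtype_le _

theorem coe_mem_U_iff {b : D.B} : (b : G) ∈ D.U p ↔ b ∈ pCore p D.B := by
  simp [U]

theorem B_le_normalizer_U (D : BNPair G) (p : ℕ) :
    D.B ≤ Subgroup.normalizer (D.U p : Set G) := by
  refine Subgroup.le_normalizer_iff.2 fun b hb x hx => ?_
  obtain ⟨x, hx, rfl⟩ := hx
  exact ⟨_, (pCore_normal p D.B).conj_mem x hx ⟨b, hb⟩, rfl⟩

theorem isPGroup_U (D : BNPair G) (p : ℕ) : IsPGroup p (D.U p) :=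
  (isPGroup_pCore p D.B).map _

theorem natCast_card_U_ne_zero {k : Type u} [Field k] [Finite G] (D : BNPair G) (hp : p.Prime)
    (hpk : (p : k) ≠ 0) : (Nat.card (D.U p) : k) ≠ 0 := by
  have := Fact.mk hp
  obtain ⟨j, hj⟩ := IsPGroup.iff_card.1 (D.isPGroup_U p)
  rw [hj, Nat.cast_pow]
  exact pow_ne_zero j hpk

namespace IsSplit

theorem exists_eq_mul_of_mem_B (hD : D.IsSplit p) {b : G} (hb : b ∈ D.B) :
    ∃ x ∈ D.U p, ∃ t ∈ D.T, b = x * t := by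
  rw [← SetLike.mem_coe, ← hD.mul_eq] at hb
  obtain ⟨x, hx, t, ht, rfl⟩ := hb
  exact ⟨x, hx, t, ht, rfl⟩

theorem pow_card_T_mem_U (hD : D.IsSplit p) {b : G} (hb : b ∈ D.B) :
    b ^ Nat.card D.T ∈ D.U p := by
  obtain ⟨x, hx, t, ht, rfl⟩ := hD.exists_eq_mul_of_mem_B hb
  let x' : D.B := ⟨x, D.U_le_B hx⟩
  let t' : D.B := ⟨t, ht.1⟩
  have ht' : t' ^ Nat.card D.T = 1 :=
    Subtype.ext (congrArg D.T.subtype (pow_card_eq_one' (x := (⟨t, ht⟩ : D.T))))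
  refine (coe_mem_U_iff (b := (x' * t') ^ Nat.card D.T)).2 ?_
  rw [← QuotientGroup.eq_one_iff, QuotientGroup.mk_pow, QuotientGroup.mk_mul,
    (QuotientGroup.eq_one_iff x').2 (coe_mem_U_iff.1 hx), one_mul, ← QuotientGroup.mk_pow, ht',
    QuotientGroup.mk_one]

theorem mem_U_of_pow_eq_one (hD : D.IsSplit p) (hp : p.Prime) {b : G} (hb : b ∈ D.B) {j : ℕ}
    (hj : b ^ p ^ j = 1) : b ∈ D.U p := by
  let b' : D.B := ⟨b, hb⟩
  have h_coprime : (p ^ j).Coprime (Nat.card D.T) :=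
    (hp.coprime_iff_not_dvd.2 hD.not_dvd).pow_left j
  have h_pow : (b' : D.B ⧸ pCore p D.B) ^ p ^ j = 1 := by
    rw [← QuotientGroup.mk_pow, show b' ^ p ^ j = 1 from Subtype.ext hj, QuotientGroup.mk_one]
  have h_card : (b' : D.B ⧸ pCore p D.B) ^ Nat.card D.T = 1 := by
    rw [← QuotientGroup.mk_pow, QuotientGroup.eq_one_iff, ← coe_mem_U_iff]
    exact hD.pow_card_T_mem_U hb
  exact coe_mem_U_iff.2 ((QuotientGroup.eq_one_iff b').1
    ((pow_eq_one_iff_of_coprime h_coprime).1 ⟨h_pow, h_card⟩))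

theorem conj_mem_U (hD : D.IsSplit p) (hp : p.Prime) {g x : G} (hx : x ∈ D.U p)
    (hgx : g * x * g⁻¹ ∈ D.B) : g * x * g⁻¹ ∈ D.U p := by
  obtain ⟨j, hj⟩ := D.isPGroup_U p ⟨x, hx⟩
  refine hD.mem_U_of_pow_eq_one hp hgx (j := j) ?_
  rw [conj_pow, show x ^ p ^ j = 1 from congrArg Subtype.val hj, mul_one, mul_inv_cancel]

end IsSplit

end Unipotent

end BNPair

namespace BNPair

section BorelIdem

open DoubleCoset

variable {k : Type u} [Field k] {G : Type v} [Group G] [Finite G] {D : BNPair G} {p : ℕ}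
  {A : Subgroup G} {χ ψ : A →* k}

variable (k D p) in
/-- The idempotent `|U|⁻¹ ∑_{x ∈ U} x` of `kG`, which projects every `kG`-module onto its
`U`-invariants. -/
noncomputable def unipIdem : k[G] := charIdem (D.U p).subtype 1

variable (D p) in
/-- The idempotent of `kG` which projects every `kG`-module `V` onto the `χ`-isotypic part of `V^U`,
where `χ` is a linear character of a subgroup `A` of `B` (in the applications, of `T`). -/
noncomputable def borelIdem (χ : A →* k) : k[G] := charIdem A.subtype χ * unipIdem k D p

theorem of_mul_unipIdem {x : G} (hx : x ∈ D.U p) :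
    of k G x * unipIdem k D p = unipIdem k D p :=
  (of_mul_charIdem _ _ (⟨x, hx⟩ : D.U p)).trans (one_smul _ _)

theorem commute_of_unipIdem {b : G} (hb : b ∈ D.B) : Commute (of k G b) (unipIdem k D p) :=
  of_mul_charIdem_subtype ⟨b, D.B_le_normalizer_U p hb⟩ 1

theorem commute_charIdem_unipIdem (hA : A ≤ D.B) (χ : A →* k) :
    Commute (charIdem A.subtype χ) (unipIdem k D p) :=
  commute_charIdem fun a => commute_of_unipIdem (hA a.2)

theorem isIdempotentElem_borelIdem (hA : A ≤ D.B) (hAk : (Nat.card A : k) ≠ 0)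
    (hUk : (Nat.card (D.U p) : k) ≠ 0) (χ : A →* k) : IsIdempotentElem (borelIdem D p χ) :=
  .mul_of_commute (commute_charIdem_unipIdem hA χ) (isIdempotentElem_charIdem _ _ hAk)
    (isIdempotentElem_charIdem _ _ hUk)

theorem of_mul_borelIdem (hA : A ≤ D.B) {x : G} (hx : x ∈ D.U p) (χ : A →* k) :
    of k G x * borelIdem D p χ = borelIdem D p χ := by
  rw [borelIdem, (commute_charIdem_unipIdem hA χ).eq, ← mul_assoc, of_mul_unipIdem hx]

theorem borelIdem_mul_of {x : G} (hx : x ∈ D.U p) (χ : A →* k) :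
    borelIdem D p χ * of k G x = borelIdem D p χ := by
  rw [borelIdem, mul_assoc, ← (commute_of_unipIdem (D.U_le_B hx)).eq, of_mul_unipIdem hx]

theorem unipIdem_mul_of_mul_borelIdem (hA : A ≤ D.B) (n : Subgroup.normalizer (A : Set G))
    (χ : A →* k) :
    unipIdem k D p * of k G n * borelIdem D p χ =
      borelIdem D p (conjChar n χ) * of k G n * unipIdem k D p := by
  rw [borelIdem, borelIdem, mul_assoc, ← mul_assoc (of k G (n : G)), of_mul_charIdem_subtype,
    (commute_charIdem_unipIdem hA _).eq]
  simp only [mul_assoc]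

theorem borelIdem_mul_of_mul_borelIdem_of_ne (hA : A ≤ D.B)
    {n : Subgroup.normalizer (A : Set G)} (h : ψ ≠ conjChar n χ) :
    borelIdem D p ψ * of k G n * borelIdem D p χ = 0 := by
  calc
    _ = unipIdem k D p * (charIdem A.subtype ψ * (of k G n * charIdem A.subtype χ)) *
        unipIdem k D p := by
      rw [borelIdem, (commute_charIdem_unipIdem hA ψ).eq, borelIdem]
      simp only [mul_assoc]
    _ = 0 := by
      rw [of_mul_charIdem_subtype, ← mul_assoc (charIdem _ _), charIdem_mul_charIdem_of_ne _ h,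
        zero_mul, mul_zero, zero_mul]

namespace IsSplit

variable (hD : D.IsSplit p) (hAT : A ≤ D.T)

include hD hAT

theorem commute_of_borelIdem {t : G} (ht : t ∈ D.T) (χ : A →* k) :
    Commute (of k G t) (borelIdem D p χ) := by
  have h_char : Commute (charIdem A.subtype χ) (of k G t) :=
    commute_charIdem fun a => Commute.map (hD.comm a (hAT a.2) t ht) (of k G)
  exact h_char.symm.mul_right (commute_of_unipIdem ht.1)

theorem exists_borelIdem_mul_of_eq {b : G} (hb : b ∈ D.B) (χ : A →* k) :
    ∃ t, borelIdem D p χ * of k G b = of k G t * borelIdem D p χ := by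
  obtain ⟨x, hx, t, ht, rfl⟩ := hD.exists_eq_mul_of_mem_B hb
  refine ⟨t, ?_⟩
  rw [map_mul, ← mul_assoc, borelIdem_mul_of hx, (hD.commute_of_borelIdem hAT ht χ).eq]

theorem exists_of_mul_borelIdem_eq {b : G} (hb : b ∈ D.B) (χ : A →* k) :
    ∃ t, of k G b * borelIdem D p χ = borelIdem D p χ * of k G t := by
  obtain ⟨x, hx, t, ht, h_eq⟩ := hD.exists_eq_mul_of_mem_B (inv_mem hb)
  refine ⟨t⁻¹, ?_⟩
  rw [← inv_inv b, h_eq, mul_inv_rev, map_mul, mul_assoc,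
    of_mul_borelIdem (hAT.trans D.T_le_B) (inv_mem hx),
    (hD.commute_of_borelIdem hAT (inv_mem ht) χ).eq]

theorem borelIdem_mul_of_mul_borelIdem_of_mem_doubleCoset
    {n : Subgroup.normalizer (A : Set G)} (h : ψ ≠ conjChar n χ) {g : G}
    (hg : g ∈ doubleCoset (n : G) (D.B : Set G) D.B) :
    borelIdem D p ψ * of k G g * borelIdem D p χ = 0 := by
  obtain ⟨b, hb, c, hc, rfl⟩ := mem_doubleCoset.1 hg
  obtain ⟨t, ht⟩ := hD.exists_borelIdem_mul_of_eq hAT hb ψ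
  obtain ⟨t', ht'⟩ := hD.exists_of_mul_borelIdem_eq hAT hc χ
  calc
    _ = borelIdem D p ψ * of k G b * of k G n * (of k G c * borelIdem D p χ) := by
      simp only [map_mul, mul_assoc]
    _ = of k G t * (borelIdem D p ψ * of k G n * borelIdem D p χ) * of k G t' := by
      rw [ht, ht']
      simp only [mul_assoc]
    _ = 0 := by
      rw [borelIdem_mul_of_mul_borelIdem_of_ne (hAT.trans D.T_le_B) h, mul_zero, zero_mul]

theorem borelIdem_mul_mul_borelIdem (hNA : D.N ≤ Subgroup.normalizer (A : Set G))
    (h : ∀ n : D.N, ψ ≠ conjChar (Subgroup.inclusion hNA n) χ) (c : k[G]) :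
    borelIdem D p ψ * c * borelIdem D p χ = 0 := by
  induction c using MonoidAlgebra.induction_on with
  | of g =>
    obtain ⟨n, hn⟩ := D.exists_mem_doubleCoset g
    exact hD.borelIdem_mul_of_mul_borelIdem_of_mem_doubleCoset hAT (h n) hn
  | add x y hx hy => rw [mul_add, add_mul, hx, hy, add_zero]
  | smul a x hx => rw [mul_smul_comm, smul_mul_assoc, hx, smul_zero]

theorem borelIdem_mul_of_mul_borelIdem_of_conj_mem (hAk : (Nat.card A : k) ≠ 0)
    (hUk : (Nat.card (D.U p) : k) ≠ 0) (χ : A →* k) {s x : G} (hs : s * s ∈ D.T)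
    (hx : s * x * s⁻¹ ∈ D.U p) :
    borelIdem D p χ * of k G (s * x * s) * borelIdem D p χ =
      of k G (s * s) * borelIdem D p χ := by
  rw [show s * x * s = s * x * s⁻¹ * (s * s) by group, map_mul, ← mul_assoc, borelIdem_mul_of hx,
    ← (hD.commute_of_borelIdem hAT hs χ).eq, mul_assoc,
    isIdempotentElem_borelIdem (hAT.trans D.T_le_B) hAk hUk]

theorem borelIdem_mul_of_mul_borelIdem_of_conj_notMem (hp : p.Prime)
    (hNA : D.N ≤ Subgroup.normalizer (A : Set G)) {s : D.N} (hs : (s : D.W) ∈ D.S)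
    (h : ψ ≠ conjChar (Subgroup.inclusion hNA s) χ) {x : G} (hx : x ∈ D.U p)
    (hsx : (s * x * (s : G)⁻¹) ∉ D.U p) :
    borelIdem D p ψ * of k G (s * x * s) * borelIdem D p χ = 0 := by
  refine hD.borelIdem_mul_of_mul_borelIdem_of_mem_doubleCoset hAT h
    ((D.mul_mem s s hs x (D.U_le_B hx)).resolve_left fun h_mem => hsx (hD.conj_mem_U hp hx ?_))
  have h_ss : (s * s : G) ∈ D.B := (mul_self_mem_T hs).1
  have h_sxs : (s * x * s : G) ∈ D.B := by
    obtain ⟨b, hb, c, hc, h_eq⟩ := mem_doubleCoset.1 h_mem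
    exact h_eq ▸ D.B.mul_mem (D.B.mul_mem hb h_ss) hc
  rw [show (s * x * (s : G)⁻¹ : G) = s * x * s * (s * s : G)⁻¹ by group]
  exact D.B.mul_mem h_sxs (inv_mem h_ss)

theorem exists_borelIdem_mul_unipIdem_mul_borelIdem_eq (hp : p.Prime)
    (hNA : D.N ≤ Subgroup.normalizer (A : Set G)) (hAk : (Nat.card A : k) ≠ 0)
    (hUk : (Nat.card (D.U p) : k) ≠ 0) {s : D.N} (hs : (s : D.W) ∈ D.S)
    (h : χ ≠ conjChar (Subgroup.inclusion hNA s) χ) :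
    ∃ a : k, a ≠ 0 ∧
      borelIdem D p χ * of k G s * unipIdem k D p * of k G s * borelIdem D p χ =
        a • (of k G (s * s : G) * borelIdem D p χ) := by
  classical
  let := Fintype.ofFinite (D.U p)
  let f := borelIdem D p χ
  -- Only the `x ∈ U ∩ s⁻¹Us` contribute to the sum defining `unipIdem`: for the other `x`, the
  -- product `sxs` lies in `BsB`.
  let K : Subgroup (D.U p) := ((D.U p).comap (MulAut.conj (s : G)).toMonoidHom).subgroupOf (D.U p)
  have hKk : (Nat.card K : k) ≠ 0 := fun h0 => hUk <| by
    rw [← K.card_mul_index, Nat.cast_mul, h0, zero_mul]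
  have h_term (x : D.U p) : f * of k G (s * x * s) * f =
      if x ∈ K then of k G (s * s : G) * f else 0 := by
    split_ifs with hx
    · exact hD.borelIdem_mul_of_mul_borelIdem_of_conj_mem hAT hAk hUk χ (mul_self_mem_T hs) hx
    · exact hD.borelIdem_mul_of_mul_borelIdem_of_conj_notMem hAT hp hNA hs h x.2 hx
  refine ⟨(Nat.card (D.U p) : k)⁻¹ * Nat.card K, mul_ne_zero (inv_ne_zero hUk) hKk, ?_⟩
  calc
    _ = (Nat.card (D.U p) : k)⁻¹ • ∑ x : D.U p, f * of k G (s * x * s) * f := by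
      simp only [f, unipIdem, charIdem, MonoidHom.one_apply, one_smul, mul_smul_comm,
        smul_mul_assoc, Finset.mul_sum, Finset.sum_mul, map_mul, mul_assoc, Subgroup.subtype_apply]
    _ = _ := by
      simp only [h_term]
      rw [← Finset.sum_filter, Finset.sum_const, mul_smul, ← Nat.cast_smul_eq_nsmul k,
        Nat.card_eq_fintype_card (α := K), Fintype.card_subtype]

theorem borelIdem_mem_of_borelIdem_conjChar_simple_mem (hp : p.Prime)
    (hNA : D.N ≤ Subgroup.normalizer (A : Set G)) (hAk : (Nat.card A : k) ≠ 0)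
    (hUk : (Nat.card (D.U p) : k) ≠ 0) {I : Ideal k[G]} [I.IsTwoSided] {s : D.N}
    (hs : (s : D.W) ∈ D.S)
    (h : borelIdem D p (conjChar (Subgroup.inclusion hNA s) χ) ∈ I) : borelIdem D p χ ∈ I := by
  by_cases hχ : χ = conjChar (Subgroup.inclusion hNA s) χ
  · rwa [hχ]
  obtain ⟨a, ha, h_quad⟩ :=
    hD.exists_borelIdem_mul_unipIdem_mul_borelIdem_eq hAT hp hNA hAk hUk hs hχ
  have h_mem : a • (of k G (s * s : G) * borelIdem D p χ) ∈ I := by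
    have h_swap := unipIdem_mul_of_mul_borelIdem (p := p) (hAT.trans D.T_le_B)
      (Subgroup.inclusion hNA s) χ
    rw [Subgroup.coe_inclusion] at h_swap
    rw [← h_quad, mul_assoc, mul_assoc, ← mul_assoc (unipIdem k D p), h_swap]
    exact I.mul_mem_left _ (I.mul_mem_right _ (I.mul_mem_right _ h))
  have h_eq : borelIdem D p χ =
      (a⁻¹ • of k G (s * s : G)⁻¹) * a • (of k G (s * s : G) * borelIdem D p χ) := by
    rw [smul_mul_smul_comm, inv_mul_cancel₀ ha, one_smul, ← mul_assoc, ← map_mul,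
      inv_mul_cancel, map_one, one_mul]
  rw [h_eq]
  exact I.mul_mem_left _ h_mem

theorem borelIdem_mem_of_borelIdem_conjChar_mem (hp : p.Prime)
    (hNA : D.N ≤ Subgroup.normalizer (A : Set G)) (hAk : (Nat.card A : k) ≠ 0)
    (hUk : (Nat.card (D.U p) : k) ≠ 0) {I : Ideal k[G]} [I.IsTwoSided] (n : D.N) (χ : A →* k)
    (h : borelIdem D p (conjChar (Subgroup.inclusion hNA n) χ) ∈ I) : borelIdem D p χ ∈ I := by
  induction n using N_induction with
  | torus t ht => 
    rwa [conjChar_eq_self (g := Subgroup.inclusion hNA t)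
      fun a ha => hD.comm t ht a (hAT ha)] at h
  | mul s n hs ih =>
    rw [map_mul, conjChar_mul] at h
    exact ih (hD.borelIdem_mem_of_borelIdem_conjChar_simple_mem hAT hp hNA hAk hUk hs h)

theorem borelIdem_conjChar_mem_iff (hp : p.Prime)
    (hNA : D.N ≤ Subgroup.normalizer (A : Set G)) (hAk : (Nat.card A : k) ≠ 0)
    (hUk : (Nat.card (D.U p) : k) ≠ 0) {I : Ideal k[G]} [I.IsTwoSided] (n : D.N) (χ : A →* k) :
    borelIdem D p (conjChar (Subgroup.inclusion hNA n) χ) ∈ I ↔ borelIdem D p χ ∈ I := by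
  refine ⟨hD.borelIdem_mem_of_borelIdem_conjChar_mem hAT hp hNA hAk hUk n χ, fun h =>
    hD.borelIdem_mem_of_borelIdem_conjChar_mem hAT hp hNA hAk hUk n⁻¹ _ ?_⟩
  rwa [map_inv, conjChar_inv_conjChar]

end IsSplit

theorem borelIdem_notMem_annihilator_iff (hA : A ≤ D.B) (hAk : (Nat.card A : k) ≠ 0)
    (hUk : (Nat.card (D.U p) : k) ≠ 0) (χ : A →* k) (V : Type*) [AddCommGroup V] [Module k V]
    [Module k[G] V] [IsScalarTower k k[G] V] :
    borelIdem D p χ ∉ Module.annihilator k[G] V ↔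
      weightSpace V A.subtype χ ⊓ weightSpace V (D.U p).subtype 1 ≠ ⊥ := by
  simp only [Module.mem_annihilator, not_forall]
  rw [Submodule.ne_bot_iff]
  constructor
  · rintro ⟨v, hv⟩
    have h_swap : borelIdem D p χ • v = unipIdem k D p • charIdem A.subtype χ • v := by
      rw [borelIdem, (commute_charIdem_unipIdem hA χ).eq, mul_smul]
    refine ⟨_, ⟨?_, h_swap ▸ charIdem_smul_mem_weightSpace _ _ _⟩, hv⟩
    rw [borelIdem, mul_smul]
    exact charIdem_smul_mem_weightSpace _ _ _
  · rintro ⟨v, ⟨hvA, hvU⟩, hv⟩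
    refine ⟨v, ?_⟩
    rwa [borelIdem, mul_smul, unipIdem, charIdem_smul_eq_self hUk hvU,
      charIdem_smul_eq_self hAk hvA]

end BorelIdem

end BNPair

section RegularPart

variable {G : Type*} [Group G]

theorem exists_eq_pow_mul_and_natCast_ne_zero (k : Type*) [Field k] (q : ℕ) [hq : ExpChar k q]
    {n : ℕ} (hn : n ≠ 0) : ∃ a m : ℕ, n = q ^ a * m ∧ (m : k) ≠ 0 := by
  cases hq with
  | zero => exact ⟨0, n, by simp, Nat.cast_ne_zero.2 hn⟩
  | prime hq =>
    obtain ⟨a, m, hm, h_eq⟩ := Nat.exists_eq_pow_mul_and_not_dvd hn q hq.ne_one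
    exact ⟨a, m, h_eq, (CharP.cast_eq_zero_iff k q m).not.2 hm⟩

/-- The subgroup of the elements of an abelian group `K ≤ G` whose order is invertible in `k`.
For `char k = r > 0` these are the `r`-regular elements of `K`, and all of them if `char k = 0`. -/
def regularPart (k : Type*) [Field k] (K : Subgroup G) [IsMulCommutative K] : Subgroup G where
  carrier := {x | x ∈ K ∧ (orderOf x : k) ≠ 0}
  one_mem' := ⟨K.one_mem, by simp⟩
  inv_mem' hx := ⟨K.inv_mem hx.1, by simpa using hx.2⟩
  mul_mem' {x y} hx hy := by
    refine ⟨K.mul_mem hx.1 hy.1, fun h0 => mul_ne_zero hx.2 hy.2 ?_⟩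
    have h_comm : Commute x y := congrArg Subtype.val (mul_comm' (⟨x, hx.1⟩ : K) ⟨y, hy.1⟩)
    obtain ⟨c, hc⟩ := h_comm.orderOf_mul_dvd_mul_orderOf
    rw [← Nat.cast_mul, hc, Nat.cast_mul, h0, zero_mul]

variable (k : Type*) [Field k] (K : Subgroup G) [IsMulCommutative K]

theorem regularPart_le : regularPart k K ≤ K := fun _ hx => hx.1

theorem normalizer_le_normalizer_regularPart :
    Subgroup.normalizer (K : Set G) ≤ Subgroup.normalizer (regularPart k K : Set G) :=
  Subgroup.le_normalizer_iff.2 fun g hg x hx =>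
    ⟨(Subgroup.mem_normalizer_iff.1 hg x).1 hx.1, ((MulAut.conj g).orderOf_eq x).symm ▸ hx.2⟩

theorem natCast_card_regularPart_ne_zero [Finite G] : (Nat.card (regularPart k K) : k) ≠ 0 := by
  obtain ⟨q, _⟩ := CharP.exists k
  rw [Ne, CharP.cast_eq_zero_iff k q]
  intro h_dvd
  have hq : q.Prime := (CharP.char_is_prime_or_zero k q).resolve_right fun h0 =>
    Nat.card_pos.ne' (zero_dvd_iff.1 (h0 ▸ h_dvd))
  have := Fact.mk hq
  obtain ⟨x, hx⟩ := exists_prime_orderOf_dvd_card' q h_dvd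
  refine x.2.2 ?_
  rw [Subgroup.orderOf_coe, hx, CharP.cast_eq_zero]

theorem injective_comp_inclusion_regularPart [Finite G] :
    Function.Injective fun χ : K →* k => χ.comp (Subgroup.inclusion (regularPart_le k K)) := by
  intro χ ψ h_eq
  ext x
  obtain ⟨q, _⟩ := ExpChar.exists k
  obtain ⟨a, m, h_order, hm⟩ := exists_eq_pow_mul_and_natCast_ne_zero k q (orderOf_pos x).ne'
  have h_reg : (orderOf ((x ^ q ^ a : K) : G) : k) ≠ 0 := by
    rw [Subgroup.orderOf_coe, orderOf_pow_of_dvd (expChar_pow_pos k q a).ne' ⟨m, h_order⟩, h_order,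
      Nat.mul_div_cancel_left _ (expChar_pow_pos k q a)]
    exact hm
  refine iterateFrobenius_inj k q a ?_
  rw [iterateFrobenius_def, iterateFrobenius_def, ← map_pow, ← map_pow]
  exact DFunLike.congr_fun h_eq ⟨_, (x ^ q ^ a).2, h_reg⟩

end RegularPart

namespace BNPair

section PrincipalSeries

variable {k : Type u} [Field k] {G : Type v} [Group G] {D : BNPair G} {p : ℕ}

theorem N_le_normalizer_T (D : BNPair G) : D.N ≤ Subgroup.normalizer (D.T : Set G) :=
  have : (D.T.subgroupOf D.N).Normal := D.normal
  Subgroup.le_normalizer_of_normal_subgroupOf inf_le_right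

theorem weightSpace_hcRestriction_ne_bot_iff {A : Subgroup G} (hAT : A ≤ D.T) (χ : A →* k)
    (Y : Rep.{w} k G) :
    weightSpace (hcRestriction p D.T_le_B Y).ρ.asModule (Subgroup.inclusion hAT) χ ≠ ⊥ ↔
      weightSpace Y.ρ.asModule A.subtype χ ⊓ weightSpace Y.ρ.asModule (D.U p).subtype 1 ≠ ⊥ := by
  rw [Submodule.ne_bot_iff, Submodule.ne_bot_iff]
  constructor
  · rintro ⟨v, hv, hv0⟩
    rw [mem_weightSpace_asModule] at hv
    let v' : Representation.invariants ((Rep.res D.B.subtype Y).ρ.comp (pCore p D.B).subtype) := v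
    refine ⟨v'.1, ⟨?_, ?_⟩, fun h0 => hv0 (Subtype.ext h0)⟩
    · exact mem_weightSpace_asModule.2 fun a => congrArg Subtype.val (hv a)
    · refine mem_weightSpace_asModule.2 ?_
      rintro ⟨-, b, hb, rfl⟩
      exact (v'.2 ⟨b, hb⟩).trans (one_smul _ _).symm
  · rintro ⟨v, ⟨hvA, hvU⟩, hv0⟩
    rw [SetLike.mem_coe, mem_weightSpace_asModule] at hvA hvU
    let v' : Representation.invariants ((Rep.res D.B.subtype Y).ρ.comp (pCore p D.B).subtype) :=
      ⟨v, fun b => (hvU ⟨b.1, b.1, b.2, rfl⟩).trans (one_smul _ _)⟩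
    refine ⟨v', mem_weightSpace_asModule.2 fun a => Subtype.ext (hvA a), fun h0 => hv0 ?_⟩
    exact congrArg Subtype.val h0

variable [IsMulCommutative D.T]

variable (k D) in
theorem N_le_normalizer_regularPart : D.N ≤ Subgroup.normalizer (regularPart k D.T : Set G) :=
  D.N_le_normalizer_T.trans (normalizer_le_normalizer_regularPart k D.T)

variable [Finite G]

variable (D p) in
theorem isCompositionFactor_hcRestriction_iff [IsAlgClosed k] (hUk : (Nat.card (D.U p) : k) ≠ 0)
    {X : Rep.{w} k D.T} (hX : X.ρ.IsIrreducible) {χ : D.T →* k}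
    (hχ : weightSpace X.ρ.asModule (.id D.T) χ = ⊤) (Y : Rep.{w} k G) :
    IsCompositionFactor X (hcRestriction p D.T_le_B Y) ↔
      borelIdem D p (χ.comp (Subgroup.inclusion (regularPart_le k D.T))) ∉
        Module.annihilator k[G] Y.ρ.asModule := by
  have hAk := natCast_card_regularPart_ne_zero k D.T
  rw [isCompositionFactor_iff hAk (injective_comp_inclusion_regularPart k D.T) hX hχ,
    weightSpace_hcRestriction_ne_bot_iff,
    borelIdem_notMem_annihilator_iff ((regularPart_le k D.T).trans D.T_le_B) hAk hUk]

theorem IsSplit.principalSeries_eq_of_comp_inclusion_eq_conjChar [IsAlgClosed k]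
    (hD : D.IsSplit p) (hp : p.Prime) (hUk : (Nat.card (D.U p) : k) ≠ 0)
    {X X' : Rep.{w} k D.T} (hX : X.ρ.IsIrreducible) (hX' : X'.ρ.IsIrreducible) {χ ψ : D.T →* k}
    (hχ : weightSpace X.ρ.asModule (.id D.T) χ = ⊤)
    (hψ : weightSpace X'.ρ.asModule (.id D.T) ψ = ⊤) (n : D.N)
    (h : ψ.comp (Subgroup.inclusion (regularPart_le k D.T)) =
      conjChar (Subgroup.inclusion (D.N_le_normalizer_regularPart k) n)
        (χ.comp (Subgroup.inclusion (regularPart_le k D.T)))) :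
    principalSeries p D X = principalSeries p D X' := by
  refine Set.ext fun Y => and_congr_right fun _ => and_congr_right fun _ => ?_
  rw [isCompositionFactor_hcRestriction_iff D p hUk hX hχ,
    isCompositionFactor_hcRestriction_iff D p hUk hX' hψ, h,
    hD.borelIdem_conjChar_mem_iff (regularPart_le k D.T) hp (D.N_le_normalizer_regularPart k)
      (natCast_card_regularPart_ne_zero k D.T) hUk]

end PrincipalSeries

end BNPair

theorem corollary4p3_general {k : Type u} [Field k] [IsAlgClosed k] {G : Type v} [Group G]
    [Finite G] {p : ℕ} (hp : p.Prime) (hpk : (p : k) ≠ 0) {D : BNPair G} (hD : D.IsSplit p)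
    {X X' : Rep.{max u v} k D.T} (hne : principalSeries p D X ≠ principalSeries p D X')
    {Y V : Rep.{max u v} k G} (hY : Y ∈ principalSeries p D X) (hV : V ∈ principalSeries p D X') :
    Subsingleton (Abelian.Ext.{max u v} (ModuleCat.of k[G] Y.ρ.asModule)
      (ModuleCat.of k[G] V.ρ.asModule) 1) := by
  have : IsMulCommutative D.T := ⟨⟨fun a b => Subtype.ext (hD.comm a a.2 b b.2)⟩⟩
  have hUk : (Nat.card (D.U p) : k) ≠ 0 := D.natCast_card_U_ne_zero hp hpk
  have hAT : regularPart k D.T ≤ D.T := regularPart_le k D.T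
  obtain ⟨hYirr, -, hXY⟩ := hY
  obtain ⟨hVirr, -, hXV⟩ := hV
  have hX := hXY.1
  have hX' := hXV.1
  obtain ⟨χ, hχ⟩ := exists_weightSpace_eq_top (k := k) (H := D.T) (V := X.ρ.asModule)
  obtain ⟨ψ, hψ⟩ := exists_weightSpace_eq_top (k := k) (H := D.T) (V := X'.ρ.asModule)
  exact subsingleton_ext_one_of_mul_mul_eq_zero
    (BNPair.isIdempotentElem_borelIdem (hAT.trans D.T_le_B)
      (natCast_card_regularPart_ne_zero k D.T) hUk _)
    (hD.borelIdem_mul_mul_borelIdem hAT (D.N_le_normalizer_regularPart k) fun n h =>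
      hne (hD.principalSeries_eq_of_comp_inclusion_eq_conjChar hp hUk hX hX' hχ hψ n h))
    ((BNPair.isCompositionFactor_hcRestriction_iff D p hUk hX hχ Y).1 hXY)
    ((BNPair.isCompositionFactor_hcRestriction_iff D p hUk hX' hψ V).1 hXV)

theorem corollary4p3 {k : Type u} [Field k] [IsAlgClosed k] {G : Type v} [Group G] [Finite G]
    (p r : ℕ) (hp : p.Prime) [CharP k r] (hr : 0 < r) (hrp : r ≠ p)
    (D : BNPair G) (hD : D.IsSplit p)
    (X X' : Rep.{max u v} k D.T) (hX : X.ρ.IsIrreducible) (hX' : X'.ρ.IsIrreducible)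
    (hne : principalSeries p D X ≠ principalSeries p D X')
    (Y V : Rep.{max u v} k G) (hY : Y ∈ principalSeries p D X) (hV : V ∈ principalSeries p D X') :
    Subsingleton (Abelian.Ext.{max u v} (ModuleCat.of k[G] Y.ρ.asModule)
      (ModuleCat.of k[G] V.ρ.asModule) 1) := by
  have hpk : (p : k) ≠ 0 := (CharP.cast_eq_zero_iff k r p).not.2 fun h =>
    ((Nat.dvd_prime hp).1 h).elim (CharP.char_ne_one k r) hrp
  exact corollary4p3_general hp hpk hD hne hY hV
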